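/- There is an absolute constant $C>0$ such that the following holds. Let $0\le\varepsilon_1<\varepsilon_2\le 1$, $\delta\in(0,1)$ and $k,n\in\mathbb N$. A Hamiltonian on $n$ qubits is a Hermitian $2^n\times 2^n$ matrix; it is $k$-local if it is a linear combination of $n$-fold tensor products of the Pauli matrices $I,X,Y,Z$ with at most $k$ non-identity factors. Distances are measured in the normalized Frobenius norm $\|A\|_2=\sqrt{\operatorname{tr}(A^\dagger A)/2^n}$, and $\|\cdot\|_\infty$ is the spectral norm. There is a non-adaptive quantum algorithm (depending only on $\varepsilon_1,\varepsilon_2,\delta,k,n$) which, for every $n$-qubit Hamiltonian $H$ with $\|H\|_\infty\le 1$, distinguishes with probability at least $1-\delta$ whether (1) $\|H-K\|_2\le\varepsilon_1$ for some $k$-local Hamiltonian $K$, or (2) $\|H-K\|_2\ge\varepsilon_2$ for all $k$-local Hamiltonians $K$: in case (1) it answers "close", and in case (2) it answers "far", each with probability at least $1-\delta$. The algorithm acts on the $n$ queried qubits and $n$ auxiliary qubits. It accesses $H$ only by applying the forward time evolution operators $e^{-iHt_j}$, $t_j\ge 0$ (without control, and without the inverse), to the $n$ queried qubits; between these queries it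 may perform measurements with post-measurement states, unitaries and resets that do not depend on $H$, and at the end it post-processes all measurement outcomes classically, possibly with randomness. The number of queries, the times $t_j$, the initial state and the intermediate operations are fixed in advance and do not depend on measurement outcomes. The number of queries is at most $$C\sqrt{\frac{\varepsilon_2}{(\varepsilon_2-\varepsilon_1)^7}}\,\log(1/\delta),$$ and the total evolution time $\sum_j t_j$ is at most $$C\sqrt{\frac{\varepsilon_2}{(\varepsilon_2-\varepsilon_1)^5}}\,\log(1/\delta).$$ -/

import Mathlib

open scoped Matrix Kronecker

/-- The four single-qubit Pauli labels. -/
inductive Pauli where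
  | I | X | Y | Z
  deriving DecidableEq

instance : Fintype Pauli where
  elems := {.I, .X, .Y, .Z}
  complete := by intro P; cases P <;> simp

/-- The single-qubit Pauli matrices. -/
noncomputable def Pauli.toMatrix : Pauli → Matrix (Fin 2) (Fin 2) ℂ
  | .I => !![1, 0; 0, 1]
  | .X => !![0, 1; 1, 0]
  | .Y => !![0, -Complex.I; Complex.I, 0]
  | .Z => !![1, 0; 0, -1]

/-- Labels of the computational basis of `n` qubits. -/
abbrev QubitIndex (n : ℕ) : Type := Fin n → Fin 2

/-- Operators on `n` qubits, i.e. complex `2^n × 2^n` matrices. -/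
abbrev QubitMatrix (n : ℕ) : Type := Matrix (QubitIndex n) (QubitIndex n) ℂ

/-- The `n`-fold tensor product of the single-qubit Pauli matrices `P 0, …, P (n-1)`. -/
noncomputable def pauliString {n : ℕ} (P : Fin n → Pauli) : QubitMatrix n :=
  Matrix.of fun x y => ∏ i, (P i).toMatrix (x i) (y i)

/-- The locality `|P|` of a Pauli string: its number of non-identity factors. -/
def pauliWeight {n : ℕ} (P : Fin n → Pauli) : ℕ :=
  (Finset.univ.filter fun i => P i ≠ Pauli.I).card

/-- `K` is a `k`-local Hamiltonian: a real linear combination of Pauli strings of weight at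
most `k` (real coefficients are exactly the Hermitian case). -/
def IsLocalHamiltonian {n : ℕ} (k : ℕ) (K : QubitMatrix n) : Prop :=
  ∃ α : (Fin n → Pauli) → ℝ, (∀ P, k < pauliWeight P → α P = 0) ∧
    K = ∑ P, (α P : ℂ) • pauliString P

/-- The normalized Frobenius norm `√(tr(A† A) / 2^n)`. -/
noncomputable def normalizedFrobenius {n : ℕ} (A : QubitMatrix n) : ℝ :=
  Real.sqrt ((Aᴴ * A).trace.re / 2 ^ n)

/-- The spectral norm (largest singular value), as the operator norm on Euclidean space. -/
noncomputable def matrixSpectralNorm {n : ℕ} (A : QubitMatrix n) : ℝ :=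
  ‖Matrix.toEuclideanCLM (𝕜 := ℂ) A‖

/-- The time evolution operator `e^{-iHt}`. -/
noncomputable def timeEvolution {n : ℕ} (H : QubitMatrix n) (t : ℝ) : QubitMatrix n :=
  NormedSpace.exp ((-(Complex.I * (t : ℂ))) • H)

/-- Basis labels of a joint register of `a` auxiliary qubits and the `n` queried qubits. -/
abbrev JointIndex (a n : ℕ) : Type := QubitIndex a × QubitIndex n

/-- A non-adaptive quantum algorithm with forward, uncontrolled query access to the time
evolution of an unknown `n`-qubit Hamiltonian, using `a` auxiliary qubits and a one-bit output.

Everything in the structure is fixed before the run and independent of the Hamiltonian and of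
all measurement outcomes. The joint register starts in the unit vector `init`. In round `j` the
evolution operator for time `time j ≥ 0` is applied to the `n` queried qubits, and then the joint
register undergoes the quantum measurement with operators `meas j o` (one per outcome `o`); this
includes unitary gates, projective measurements, and resets. After the last round the list
of all outcomes is post-processed classically, possibly with private randomness: `accept o` is
the probability of answering "close" on the outcome list `o`. -/
structure NonadaptiveAlgorithm (n a : ℕ) where
  /-- number of queries -/
  queries : ℕ
  /-- evolution times of the queries -/
  time : Fin queries → ℝ
  time_nonneg : ∀ j, 0 ≤ time j
  /-- number of possible outcomes of each measurement -/
  outcomes : ℕ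
  /-- initial state -/
  init : JointIndex a n → ℂ
  init_unit : ∑ x, ‖init x‖ ^ 2 = 1
  /-- measurement operators -/
  meas : Fin queries → Fin outcomes → Matrix (JointIndex a n) (JointIndex a n) ℂ
  meas_complete : ∀ j, ∑ o, (meas j o)ᴴ * meas j o = 1
  /-- classical post-processing -/
  accept : (Fin queries → Fin outcomes) → ℝ
  accept_mem : ∀ o, accept o ∈ Set.Icc (0 : ℝ) 1

namespace NonadaptiveAlgorithm

variable {n a : ℕ}

/-- The total evolution time: the sum of the times of all queries. -/
noncomputable def totalTime (𝒜 : NonadaptiveAlgorithm n a) : ℝ := ∑ j, 𝒜.time j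

/-- The unnormalized final state of the run on `H` in the branch with outcomes `o`. -/
noncomputable def branchState (𝒜 : NonadaptiveAlgorithm n a) (H : QubitMatrix n)
    (o : Fin 𝒜.queries → Fin 𝒜.outcomes) : JointIndex a n → ℂ :=
  Fin.foldl 𝒜.queries
    (fun v j => 𝒜.meas j (o j) *ᵥ
      (((1 : QubitMatrix a) ⊗ₖ timeEvolution H (𝒜.time j)) *ᵥ v))
    𝒜.init

/-- The probability (Born rule) of the outcome list `o` when run on `H`. -/
noncomputable def outcomeProb (𝒜 : NonadaptiveAlgorithm n a) (H : QubitMatrix n)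
    (o : Fin 𝒜.queries → Fin 𝒜.outcomes) : ℝ :=
  ∑ x, ‖𝒜.branchState H o x‖ ^ 2

/-- The probability of answering "close" when run on `H`. -/
noncomputable def probClose (𝒜 : NonadaptiveAlgorithm n a) (H : QubitMatrix n) : ℝ :=
  ∑ o, 𝒜.outcomeProb H o * 𝒜.accept o

/-- The probability of answering "far" when run on `H`. -/
noncomputable def probFar (𝒜 : NonadaptiveAlgorithm n a) (H : QubitMatrix n) : ℝ :=
  ∑ o, 𝒜.outcomeProb H o * (1 - 𝒜.accept o)

end NonadaptiveAlgorithm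

/-!
Write a joint state of the auxiliary and the queried qubits as a matrix `M`, so that a Hamiltonian
acts by left multiplication (`choiVector`, `jointOperator_choiVector`). The Pauli strings become
the orthonormal Bell basis, the identity becomes the maximally entangled state `e`, and `H e` is the
vector of `H` itself. If `Q` is the projection onto the Pauli strings of weight above `k`, then the
distance of `H` from the `k`-local Hamiltonians is `η = ‖Q H e‖` (`norm_coordProj_choiVector_le`,
`exists_isLocal_normalizedFrobenius_eq`), so the task is to estimate `η`.

A trial starts in `e` and alternates short evolutions for time `s` with measurements that
postselect on the span `P` of `e` and the range of `Q`, for a total time `τ`. By the quantum Zeno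
effect the state follows the evolution generated by `P H P`, and leaks into the range of `Q` with
amplitude `τ η`, up to an additive error `O(τ s)` and a relative error of only `O(τ²)`: after
subtracting the mean energy, the terms of first and second order in `τ` are orthogonal over the
reals (`norm_leak_zenoAnsatz`, `zeno_leak_bounds`). With `Δ = ε₂ - ε₁`, taking `τ` of order
`√(Δ/ε₂)` and `s` of order `Δ` separates the two cases.

A trial ends with a measurement in the Bell basis and a reset to `e`, so successive trials are
independent and the outcome probabilities multiply (`foldl_trialState`). The detection
probability is of order `τ² ε₂²` with a gap of order `τ² ε₂ Δ`, so a Chernoff bound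
(`leakTester_correct`) shows that `log(1/δ) / (τ² Δ²)`, that is `log(1/δ) ε₂ / Δ³` up to constants,
trials suffice. Multiplying by the `τ / s` queries and by the time `τ` of each trial gives the two
bounds of the theorem.
-/

/-! ### Second-order expansion of the exponential -/

lemma norm_exp_sub_one_sub_self_le {R : Type*} [NormedRing R] [NormedAlgebra ℂ R]
    [CompleteSpace R] (X : R) (hX : ‖X‖ ≤ 1) :
    ‖NormedSpace.exp X - 1 - X‖ ≤ ‖X‖ ^ 2 := by
  have h1 := NormedSpace.exp_series_hasSum_exp' (𝕂 := ℂ) X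
  have h2 := (hasSum_nat_add_iff' 2).mpr h1
  have h3 := (hasSum_nat_add_iff' 2).mpr (NormedSpace.exp_series_hasSum_exp' (𝕂 := ℝ) ‖X‖)
  have e2 : NormedSpace.exp X - ∑ i ∈ Finset.range 2, ((i.factorial : ℂ)⁻¹) • X ^ i
      = NormedSpace.exp X - 1 - X := by
    simp [Finset.sum_range_succ, sub_sub]
  have e3 : NormedSpace.exp ‖X‖ - ∑ i ∈ Finset.range 2, ((i.factorial : ℝ)⁻¹) • ‖X‖ ^ i
      = Real.exp ‖X‖ - 1 - ‖X‖ := by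
    simp [Finset.sum_range_succ, sub_sub, Real.exp_eq_exp_ℝ]
  rw [e2] at h2
  rw [e3] at h3
  have h4 : ‖NormedSpace.exp X - 1 - X‖ ≤ Real.exp ‖X‖ - 1 - ‖X‖ := by
    refine h2.norm_le_of_bounded h3 fun i => ?_
    rw [norm_smul, norm_inv, smul_eq_mul, Complex.norm_natCast]
    gcongr
    exact norm_pow_le' X (by omega)
  exact h4.trans ((le_abs_self _).trans
    (Real.abs_exp_sub_one_sub_id_le (by rwa [abs_of_nonneg (norm_nonneg X)])))

/-! ### Coordinate projections of an orthonormal basis -/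

section CoordProj

open InnerProductSpace

variable {E : Type*} [NormedAddCommGroup E] [InnerProductSpace ℂ E]
  {ι : Type*} [Fintype ι]

/-- The orthogonal projection onto the span of the basis vectors with label in `S`. -/
noncomputable def coordProj (b : OrthonormalBasis ι ℂ E) (S : Finset ι) : E →L[ℂ] E :=
  ∑ i ∈ S, rankOne ℂ (b i) (b i)

lemma coordProj_apply (b : OrthonormalBasis ι ℂ E) (S : Finset ι) (x : E) :
    coordProj b S x = ∑ i ∈ S, inner ℂ (b i) x • b i := by
  simp [coordProj]

lemma inner_coordProj_left (b : OrthonormalBasis ι ℂ E) (S : Finset ι) (x y : E) :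
    inner ℂ (coordProj b S x) y = inner ℂ x (coordProj b S y) := by
  simp only [coordProj_apply, inner_sum, sum_inner, inner_smul_left, inner_smul_right]
  refine Finset.sum_congr rfl fun i _ => ?_
  rw [inner_conj_symm, mul_comm]

variable [DecidableEq ι]

lemma inner_coordProj (b : OrthonormalBasis ι ℂ E) (S : Finset ι) (x : E) (i : ι) :
    inner ℂ (b i) (coordProj b S x) = if i ∈ S then inner ℂ (b i) x else 0 := by
  rw [coordProj_apply, inner_sum]
  simp [inner_smul_right, b.inner_eq_ite]

lemma coordProj_coordProj (b : OrthonormalBasis ι ℂ E) (S T : Finset ι) (x : E) :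
    coordProj b S (coordProj b T x) = coordProj b (S ∩ T) x := by
  refine b.repr.injective (PiLp.ext fun i => ?_)
  simp only [b.repr_apply_apply, inner_coordProj, Finset.mem_inter, ite_and]

lemma norm_coordProj_sq (b : OrthonormalBasis ι ℂ E) (S : Finset ι) (x : E) :
    ‖coordProj b S x‖ ^ 2 = ∑ i ∈ S, ‖inner ℂ (b i) x‖ ^ 2 := by
  rw [← b.sum_sq_norm_inner_right]
  simp only [inner_coordProj, apply_ite norm, norm_zero, ite_pow]
  simp

lemma norm_coordProj_le (b : OrthonormalBasis ι ℂ E) (S : Finset ι) (x : E) :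
    ‖coordProj b S x‖ ≤ ‖x‖ := by
  refine le_of_sq_le_sq ?_ (norm_nonneg _)
  rw [norm_coordProj_sq, ← b.sum_sq_norm_inner_right x]
  exact Finset.sum_le_univ_sum_of_nonneg fun i => by positivity

lemma coordProj_basis (b : OrthonormalBasis ι ℂ E) (S : Finset ι) (i : ι) :
    coordProj b S (b i) = if i ∈ S then b i else 0 := by
  simp [coordProj_apply, b.inner_eq_ite]

lemma coordProj_insert (b : OrthonormalBasis ι ℂ E) {S : Finset ι} {i : ι} (hi : i ∉ S) (x : E) :
    coordProj b (insert i S) x = inner ℂ (b i) x • b i + coordProj b S x := by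
  simp [coordProj_apply, Finset.sum_insert hi]

end CoordProj

/-! ### The quantum Zeno estimate for centered operators -/

section Zeno

variable {E : Type*} [NormedAddCommGroup E] [InnerProductSpace ℂ E]

/-- The quadratic ansatz `e - i t v - (t²/2) w` for the postselected state at time `t`. -/
noncomputable def zenoAnsatz (e v w : E) (t : ℝ) : E :=
  e - (Complex.I * (t : ℂ)) • v - ((t : ℂ) ^ 2 / 2) • w

lemma norm_zenoAnsatz_le {e v w : E} {t : ℝ} (he : ‖e‖ = 1) (hw : ‖w‖ ≤ 2 * ‖v‖) (hv : ‖v‖ ≤ 2)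
    (h0 : 0 ≤ t) (h1 : t ≤ 1) : ‖zenoAnsatz e v w t‖ ≤ 5 := by
  have h : ‖zenoAnsatz e v w t‖ ≤ ‖e‖ + t * ‖v‖ + t ^ 2 / 2 * ‖w‖ := by
    refine (norm_sub_le _ _).trans
      (add_le_add ((norm_sub_le _ _).trans (le_of_eq ?_)) (le_of_eq ?_))
    · simp [norm_smul, abs_of_nonneg h0]
    · simp [norm_smul]
  have h2 : t * ‖v‖ ≤ 1 * 2 := by gcongr
  have h3 : t ^ 2 / 2 * ‖w‖ ≤ 1 ^ 2 / 2 * (2 * 2) := by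
    gcongr
    linarith
  linarith

/-- One round of evolution and postselection follows the ansatz up to a defect of second order in
the step `s`: the terms of first order in `s` cancel up to one of size `s t² ‖v‖`. -/
lemma norm_step_sub_zenoAnsatz_le {T A P : E →L[ℂ] E} {e v : E} {s t τ : ℝ}
    (hT : ‖T‖ ≤ 2) (hs0 : 0 ≤ s) (hA : ‖A - (1 - (Complex.I * (s : ℂ)) • T)‖ ≤ 4 * s ^ 2)
    (hP : ∀ x, ‖P x‖ ≤ ‖x‖) (hPe : P e = e) (hPT : P (T e) = v) (hPv : P v = v)
    (hPP : ∀ x, P (P x) = P x) (he : ‖e‖ = 1) (h0 : 0 ≤ t) (htτ : t ≤ τ) (hτ : τ ≤ 1) :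
    ‖P (A (zenoAnsatz e v (P (T v)) t)) - zenoAnsatz e v (P (T v)) (t + s)‖
      ≤ 22 * s ^ 2 + 2 * s * τ ^ 2 * ‖v‖ := by
  set w := P (T v) with hw
  have hTx : ∀ x, ‖P (T x)‖ ≤ 2 * ‖x‖ := fun x =>
    (hP _).trans ((T.le_opNorm x).trans (by gcongr))
  have hv2 : ‖v‖ ≤ 2 := by simpa [hPT, he] using hTx e
  have hw2 : ‖w‖ ≤ 2 * ‖v‖ := hTx v
  have hχ := norm_zenoAnsatz_le he hw2 hv2 h0 (htτ.trans hτ)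
  set χ := zenoAnsatz e v w t with hχd
  have hsplit : P (A χ) - zenoAnsatz e v w (t + s) =
      P ((A - (1 - (Complex.I * (s : ℂ)) • T)) χ) +
        (((s : ℂ) ^ 2 / 2) • w + (Complex.I * s * t ^ 2 / 2 : ℂ) • P (T w)) := by
    have hPw : P w = w := hPP _
    have hI : (Complex.I : ℂ) * Complex.I = -1 := Complex.I_mul_I
    simp only [hχd, zenoAnsatz, _root_.sub_apply, _root_.smul_apply,
      one_apply_eq_self, map_sub, map_smul, hPe, hPT, hPv, hPw, ← hw]
    push_cast
    match_scalars <;> first | ring1 | linear_combination ((s : ℂ) * t) * hI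
  rw [hsplit]
  have e1 : ‖P ((A - (1 - (Complex.I * (s : ℂ)) • T)) χ)‖ ≤ 4 * s ^ 2 * 5 :=
    (hP _).trans ((ContinuousLinearMap.le_opNorm _ _).trans (by gcongr))
  have e2 : ‖((s : ℂ) ^ 2 / 2) • w‖ ≤ s ^ 2 / 2 * (2 * 2) := by
    rw [norm_smul]
    simp only [norm_div, norm_pow, Complex.norm_real, Real.norm_eq_abs, sq_abs, Complex.norm_ofNat]
    gcongr
    linarith
  have e3 : ‖(Complex.I * s * t ^ 2 / 2 : ℂ) • P (T w)‖ ≤ s * τ ^ 2 / 2 * (2 * (2 * ‖v‖)) := by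
    rw [norm_smul]
    simp only [norm_div, norm_mul, norm_pow, Complex.norm_real, Real.norm_eq_abs, sq_abs,
      Complex.norm_ofNat, Complex.norm_I, one_mul, abs_of_nonneg hs0]
    gcongr
    exact (hTx w).trans (by gcongr)
  calc _ ≤ _ := norm_add_le _ _
    _ ≤ 4 * s ^ 2 * 5 + (s ^ 2 / 2 * (2 * 2) + s * τ ^ 2 / 2 * (2 * (2 * ‖v‖))) :=
      add_le_add e1 ((norm_add_le _ _).trans (add_le_add e2 e3))
    _ = _ := by ring

/-- The defects of the single rounds add up, since evolution and postselection are contractions. -/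
lemma norm_zeno_sub_ansatz_le {T A P : E →L[ℂ] E} {e v : E} {s : ℝ} {m : ℕ}
    (hT : ‖T‖ ≤ 2) (hs0 : 0 ≤ s) (hA1 : ∀ x, ‖A x‖ ≤ ‖x‖)
    (hA : ‖A - (1 - (Complex.I * (s : ℂ)) • T)‖ ≤ 4 * s ^ 2)
    (hP : ∀ x, ‖P x‖ ≤ ‖x‖) (hPe : P e = e) (hPT : P (T e) = v) (hPv : P v = v)
    (hPP : ∀ x, P (P x) = P x) (he : ‖e‖ = 1) (hτ : m * s ≤ 1) (j : ℕ) (hj : j ≤ m) :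
    ‖((P * A) ^ j) e - zenoAnsatz e v (P (T v)) (j * s)‖
      ≤ j * (22 * s ^ 2 + 2 * s * (m * s) ^ 2 * ‖v‖) := by
  induction j with
  | zero => simp [zenoAnsatz]
  | succ j ih =>
    have hstep := norm_step_sub_zenoAnsatz_le (t := j * s) hT hs0 hA hP hPe hPT hPv hPP he
      (by positivity) (by gcongr; omega : (j : ℝ) * s ≤ m * s) hτ
    have hrec : ‖P (A (((P * A) ^ j) e - zenoAnsatz e v (P (T v)) (j * s)))‖
        ≤ j * (22 * s ^ 2 + 2 * s * (m * s) ^ 2 * ‖v‖) :=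
      (hP _).trans ((hA1 _).trans (ih (by omega)))
    have hsucc : ((P * A) ^ (j + 1)) e = P (A (((P * A) ^ j) e)) := by
      rw [pow_succ']; rfl
    have ht : ((j + 1 : ℕ) : ℝ) * s = j * s + s := by push_cast; ring
    rw [hsucc, ht]
    calc _ = ‖P (A (((P * A) ^ j) e - zenoAnsatz e v (P (T v)) (j * s))) +
          (P (A (zenoAnsatz e v (P (T v)) (j * s)))
            - zenoAnsatz e v (P (T v)) (j * s + s))‖ := by
          simp only [map_sub]; congr 1; abel
      _ ≤ _ := (norm_add_le _ _).trans (add_le_add hrec hstep)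
      _ = _ := by push_cast; ring

/-- The leaked part of the ansatz has norm `t ‖v‖` up to a *relative* error of order `t²`: its
first- and second-order terms are orthogonal over `ℝ`, because `⟪v, w⟫` is real. -/
lemma norm_leak_zenoAnsatz {Q : E →L[ℂ] E} {e v w : E} {t : ℝ}
    (hQ : ∀ x, ‖Q x‖ ≤ ‖x‖) (hQe : Q e = 0) (hQv : Q v = v) (hw : ‖w‖ ≤ 2 * ‖v‖)
    (hvw : (inner ℂ v (Q w)).im = 0) (h0 : 0 ≤ t) :
    t * ‖v‖ ≤ ‖Q (zenoAnsatz e v w t)‖ ∧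
      ‖Q (zenoAnsatz e v w t)‖ ≤ t * ‖v‖ + t ^ 3 * ‖v‖ := by
  have hQχ : Q (zenoAnsatz e v w t)
      = -((Complex.I * (t : ℂ)) • v + ((t : ℂ) ^ 2 / 2) • Q w) := by
    simp only [zenoAnsatz, map_sub, map_smul, hQe, hQv]
    abel
  have hsq : ‖Q (zenoAnsatz e v w t)‖ ^ 2 = t ^ 2 * ‖v‖ ^ 2 + t ^ 4 / 4 * ‖Q w‖ ^ 2 := by
    have hre : RCLike.re (inner ℂ ((Complex.I * (t : ℂ)) • v) (((t : ℂ) ^ 2 / 2) • Q w)) = 0 := by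
      rw [inner_smul_left, inner_smul_right]
      have : ((t : ℂ) ^ 2 / 2) = ((t ^ 2 / 2 : ℝ) : ℂ) := by push_cast; ring
      have him : ((t : ℂ) ^ 2).im = 0 := by rw [← Complex.ofReal_pow, Complex.ofReal_im]
      rw [this]
      simp [hvw, him]
    rw [hQχ, norm_neg, norm_add_sq (𝕜 := ℂ), hre, norm_smul, norm_smul]
    simp only [norm_div, norm_mul, norm_pow, Complex.norm_real, Real.norm_eq_abs,
      Complex.norm_ofNat, Complex.norm_I, one_mul, abs_of_nonneg h0]
    ring
  have hQw : ‖Q w‖ ^ 2 ≤ (2 * ‖v‖) ^ 2 := by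
    gcongr
    exact (hQ w).trans hw
  have hv := norm_nonneg v
  constructor
  · refine le_of_sq_le_sq ?_ (norm_nonneg _)
    rw [hsq, mul_pow]
    have : 0 ≤ t ^ 4 / 4 * ‖Q w‖ ^ 2 := by positivity
    linarith
  · refine le_of_sq_le_sq ?_ (by positivity)
    rw [hsq]
    have h1 : t ^ 4 / 4 * ‖Q w‖ ^ 2 ≤ t ^ 4 / 4 * (2 * ‖v‖) ^ 2 := by gcongr
    have h2 : 0 ≤ t ^ 4 * ‖v‖ ^ 2 + t ^ 6 * ‖v‖ ^ 2 := by positivity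
    nlinarith

/-- The Zeno estimate when `e` has mean energy zero, so that `T e` has no component along `e`
and `P T e = Q T e = v`. -/
lemma zeno_leak_bounds_of_centered {T A P Q : E →L[ℂ] E} {e v : E} {s : ℝ} {m : ℕ}
    (hT : ‖T‖ ≤ 2) (hTs : ∀ x y, inner ℂ (T x) y = inner ℂ x (T y)) (hs0 : 0 ≤ s)
    (hA1 : ∀ x, ‖A x‖ ≤ ‖x‖)
    (hA : ‖A - (1 - (Complex.I * (s : ℂ)) • T)‖ ≤ 4 * s ^ 2)
    (hP : ∀ x, ‖P x‖ ≤ ‖x‖) (hPe : P e = e) (hPT : P (T e) = v) (hPv : P v = v)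
    (hPP : ∀ x, P (P x) = P x) (he : ‖e‖ = 1) (hτ : m * s ≤ 1)
    (hQ : ∀ x, ‖Q x‖ ≤ ‖x‖) (hQs : ∀ x y, inner ℂ (Q x) y = inner ℂ x (Q y))
    (hPs : ∀ x y, inner ℂ (P x) y = inner ℂ x (P y))
    (hQe : Q e = 0) (hQv : Q v = v) :
    |‖Q (((P * A) ^ m) e)‖ - m * s * ‖v‖| ≤ 22 * (m * s) * s + 3 * (m * s) ^ 3 * ‖v‖ := by
  have hw : ‖P (T v)‖ ≤ 2 * ‖v‖ := (hP _).trans ((T.le_opNorm v).trans (by gcongr))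
  have him : (inner ℂ v (Q (P (T v)))).im = 0 := by
    rw [← hQs, hQv, ← hPs, hPv]
    exact Complex.conj_eq_iff_im.mp (by rw [inner_conj_symm, hTs])
  obtain ⟨hl, hu⟩ := norm_leak_zenoAnsatz (t := m * s) (e := e) hQ hQe hQv hw him (by positivity)
  have hd := norm_zeno_sub_ansatz_le hT hs0 hA1 hA hP hPe hPT hPv hPP he hτ m le_rfl
  have hd' : |‖Q (((P * A) ^ m) e)‖ - ‖Q (zenoAnsatz e v (P (T v)) (m * s))‖| ≤
      m * (22 * s ^ 2 + 2 * s * (m * s) ^ 2 * ‖v‖) := by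
    refine (abs_norm_sub_norm_le _ _).trans ?_
    rw [← map_sub]
    exact (hQ _).trans hd
  have hv := norm_nonneg v
  have : 0 ≤ (m * s) ^ 3 * ‖v‖ := by positivity
  rw [abs_le] at hd' ⊢
  constructor <;> nlinarith [hd'.1, hd'.2]

end Zeno

/-! ### The quantum Zeno estimate for unitary evolution -/

section Evolution

variable {E : Type*} [NormedAddCommGroup E] [InnerProductSpace ℂ E] [CompleteSpace E]

lemma norm_exp_selfAdjoint_apply {G : E →L[ℂ] E} (hG : IsSelfAdjoint G) (t : ℝ) (x : E) :
    ‖NormedSpace.exp ((-(Complex.I * (t : ℂ))) • G) x‖ = ‖x‖ := by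
  have hskew : (-(Complex.I * (t : ℂ))) • G ∈ skewAdjoint (E →L[ℂ] E) := by
    rw [skewAdjoint.mem_iff, star_smul, hG.star_eq, ← neg_smul]
    simp
  let _ : NormedAlgebra ℚ (E →L[ℂ] E) := .restrictScalars ℚ ℂ _
  have hu := NormedSpace.exp_mem_unitary_of_mem_skewAdjoint hskew
  exact ContinuousLinearMap.norm_map_of_mem_unitary hu x

lemma inner_selfAdjoint {T : E →L[ℂ] E} (hT : IsSelfAdjoint T) (x y : E) :
    inner ℂ (T x) y = inner ℂ x (T y) :=
  (ContinuousLinearMap.isSelfAdjoint_iff_isSymmetric.mp hT) x y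

variable {ι : Type*} [Fintype ι] [DecidableEq ι]

/-- The quantum Zeno estimate. Starting from `b i₀`, `m` rounds of evolution for time `s`, each
postselected on the span of `b i₀` and the `b i` with `i ∈ S`, produce in the `S`-directions
an amplitude `m s ‖Q G b i₀‖` up to an additive error of order `(m s) s` and a relative
error of order `(m s)²`. -/
theorem zeno_leak_bounds (b : OrthonormalBasis ι ℂ E) {i₀ : ι} {S : Finset ι} (hi : i₀ ∉ S)
    {G : E →L[ℂ] E} (hG : IsSelfAdjoint G) (hG1 : ‖G‖ ≤ 1) {s : ℝ} {m : ℕ} (hs : 0 ≤ s)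
    (hs2 : 2 * s ≤ 1) (hτ : m * s ≤ 1) :
    |‖coordProj b S (((coordProj b (insert i₀ S) *
          NormedSpace.exp ((-(Complex.I * (s : ℂ))) • G)) ^ m) (b i₀))‖
        - m * s * ‖coordProj b S (G (b i₀))‖|
      ≤ 22 * (m * s) * s + 3 * (m * s) ^ 3 * ‖coordProj b S (G (b i₀))‖ := by
  -- Subtracting the mean energy `h` of `b i₀` changes the evolution only by a phase.
  set e := b i₀ with he
  have he1 : ‖e‖ = 1 := b.norm_eq_one i₀
  set h : ℝ := (inner ℂ e (G e)).re with hh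
  have hreal : (h : ℂ) = inner ℂ e (G e) := by
    refine Complex.conj_eq_iff_re.mp ?_
    rw [inner_conj_symm, inner_selfAdjoint hG]
  have hh1 : |h| ≤ 1 := by
    refine (Complex.abs_re_le_norm _).trans ((norm_inner_le_norm _ _).trans ?_)
    have := G.le_opNorm e
    rw [he1] at this ⊢
    linarith
  set T : E →L[ℂ] E := G - (h : ℂ) • 1 with hT
  have hTs : IsSelfAdjoint T := by
    refine hG.sub (IsSelfAdjoint.smul ?_ (IsSelfAdjoint.one _))
    exact Complex.conj_ofReal h
  have hT2 : ‖T‖ ≤ 2 := by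
    refine (norm_sub_le _ _).trans ?_
    have h1 : ‖(h : ℂ) • (1 : E →L[ℂ] E)‖ ≤ 1 * 1 := by
      rw [norm_smul]
      have : ‖(h : ℂ)‖ ≤ 1 := by simpa using hh1
      gcongr
      exact ContinuousLinearMap.norm_id_le
    linarith
  set A := NormedSpace.exp ((-(Complex.I * (s : ℂ))) • T) with hAdef
  set z : ℂ := Complex.exp (-(Complex.I * s) * h) with hz
  have hz1 : ‖z‖ = 1 := by
    rw [hz, Complex.norm_exp]
    simp
  have hexp : NormedSpace.exp ((-(Complex.I * (s : ℂ))) • G) = z • A := by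
    have hsum : (-(Complex.I * (s : ℂ))) • G
        = algebraMap ℂ (E →L[ℂ] E) (-(Complex.I * s) * h) + (-(Complex.I * (s : ℂ))) • T := by
      rw [hT, Algebra.algebraMap_eq_smul_one, smul_sub, smul_smul]
      abel
    let _ : NormedAlgebra ℚ (E →L[ℂ] E) := .restrictScalars ℚ ℂ _
    rw [hsum, NormedSpace.exp_add_of_commute (Algebra.commutes _ _),
      ← NormedSpace.algebraMap_exp_comm, ← Complex.exp_eq_exp_ℂ,
      Algebra.algebraMap_eq_smul_one, smul_mul_assoc, one_mul]
  have hA1 : ∀ x, ‖A x‖ ≤ ‖x‖ := fun x => (norm_exp_selfAdjoint_apply hTs s x).le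
  have hX : ‖(-(Complex.I * (s : ℂ))) • T‖ ≤ 2 * s := by
    rw [norm_smul]
    simp only [norm_neg, norm_mul, Complex.norm_I, one_mul, Complex.norm_real, Real.norm_eq_abs,
      abs_of_nonneg hs]
    nlinarith
  have hA : ‖A - (1 - (Complex.I * (s : ℂ)) • T)‖ ≤ 4 * s ^ 2 := by
    have := norm_exp_sub_one_sub_self_le _ (hX.trans hs2)
    have h2 : ‖(-(Complex.I * (s : ℂ))) • T‖ ^ 2 ≤ (2 * s) ^ 2 := by gcongr
    have h3 : A - (1 - (Complex.I * (s : ℂ)) • T) = A - 1 - (-(Complex.I * (s : ℂ))) • T := by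
      rw [neg_smul]; abel
    rw [h3]
    linarith
  have hcent : inner ℂ e (T e) = 0 := by
    have hTe : T e = G e - (h : ℂ) • e := by simp [hT]
    rw [hTe, inner_sub_right, inner_smul_right, ← hreal, inner_self_eq_norm_sq_to_K, he1]
    simp
  have hQe : coordProj b S e = 0 := by rw [he, coordProj_basis, if_neg hi]
  have hQT : coordProj b S (T e) = coordProj b S (G e) := by
    have hTe : T e = G e - (h : ℂ) • e := by simp [hT]
    rw [hTe, map_sub, map_smul, hQe, smul_zero, sub_zero]
  have hPT : coordProj b (insert i₀ S) (T e) = coordProj b S (G e) := by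
    rw [coordProj_insert b hi, ← he, hcent, hQT, zero_smul, zero_add]
  have hPv : coordProj b (insert i₀ S) (coordProj b S (G e)) = coordProj b S (G e) := by
    rw [coordProj_coordProj, Finset.inter_eq_right.mpr (Finset.subset_insert _ _)]
  have hPP : ∀ x, coordProj b (insert i₀ S) (coordProj b (insert i₀ S) x)
      = coordProj b (insert i₀ S) x := fun x => by rw [coordProj_coordProj, Finset.inter_self]
  have hQv : coordProj b S (coordProj b S (G e)) = coordProj b S (G e) := by
    rw [coordProj_coordProj, Finset.inter_self]
  have hPe : coordProj b (insert i₀ S) e = e := by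
    rw [he, coordProj_basis, if_pos (Finset.mem_insert_self _ _)]
  have key := zeno_leak_bounds_of_centered (T := T) (A := A) (P := coordProj b (insert i₀ S))
    (Q := coordProj b S) (e := e) (v := coordProj b S (G e)) (m := m) hT2 (inner_selfAdjoint hTs)
    hs hA1 hA (norm_coordProj_le b _) hPe hPT hPv hPP he1 hτ (norm_coordProj_le b _)
    (inner_coordProj_left b _) (inner_coordProj_left b _) hQe hQv
  rw [hexp, mul_smul_comm, smul_pow]
  simpa [norm_smul, hz1] using key

end Evolution

/-! ### A single trial and its repetition -/

/-- A fold over `N * m` indices is an `N`-fold iteration of folds over `m` indices. -/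
lemma foldl_mul {α : Type*} (N m : ℕ) (f : α → Fin (N * m) → α) (x : α) :
    Fin.foldl (N * m) f x
      = Fin.foldl N (fun v i => Fin.foldl m (fun w k => f w (finProdFinEquiv (i, k))) v) x := by
  induction N with
  | zero => simp
  | succ N ih =>
    rw [Fin.foldl_congr (Nat.succ_mul N m), Fin.foldl_add, ih, Fin.foldl_succ_last]
    congr 1
    funext w k
    congr 1
    ext
    simp [add_comm, mul_comm]

section Trial

open InnerProductSpace

variable {E : Type*} [NormedAddCommGroup E] [InnerProductSpace ℂ E]
  {ι : Type*} [Fintype ι]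

/-- The measurement at the end of a trial: measure in the basis `b` and reset to `b i₀`. -/
noncomputable def resetKraus (b : OrthonormalBasis ι ℂ E) (i₀ i : ι) : E →L[ℂ] E :=
  rankOne ℂ (b i₀) (b i)

lemma sum_star_resetKraus [CompleteSpace E] (b : OrthonormalBasis ι ℂ E) (i₀ : ι) :
    ∑ i, star (resetKraus b i₀ i) * resetKraus b i₀ i = 1 := by
  have h : ∀ i, star (resetKraus b i₀ i) * resetKraus b i₀ i = rankOne ℂ (b i) (b i) := by
    intro i
    rw [resetKraus, ContinuousLinearMap.star_eq_adjoint, adjoint_rankOne,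
      ContinuousLinearMap.mul_def, rankOne_comp_rankOne]
    simp
  simp_rw [h]
  exact b.sum_rankOne_eq_id

lemma isSelfAdjoint_coordProj [CompleteSpace E] (b : OrthonormalBasis ι ℂ E) (S : Finset ι) :
    IsSelfAdjoint (coordProj b S) :=
  ContinuousLinearMap.isSelfAdjoint_iff_isSymmetric.mpr (inner_coordProj_left b S)

/-- A complete measurement preserves total probability. -/
lemma sum_norm_kraus_sq [CompleteSpace E] {κ : Type*} [Fintype κ] {K : κ → E →L[ℂ] E}
    (hK : ∑ i, star (K i) * K i = 1) (x : E) : ∑ i, ‖K i x‖ ^ 2 = ‖x‖ ^ 2 := by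
  have h : ∀ i, ((‖K i x‖ ^ 2 : ℝ) : ℂ) = inner ℂ x ((star (K i) * K i) x) := by
    intro i
    rw [ContinuousLinearMap.star_eq_adjoint, mul_apply_eq_comp,
      ContinuousLinearMap.adjoint_inner_right, inner_self_eq_norm_sq_to_K]
    simp
  have h2 : ((∑ i, ‖K i x‖ ^ 2 : ℝ) : ℂ) = ((‖x‖ ^ 2 : ℝ) : ℂ) := by
    rw [Complex.ofReal_sum]
    simp_rw [h]
    rw [← inner_sum, ← _root_.sum_apply, hK, one_apply_eq_self,
      inner_self_eq_norm_sq_to_K]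
    simp
  exact_mod_cast h2

lemma sum_norm_foldl_sq {V κ : Type*} [NormedAddCommGroup V] [Fintype κ] (m : ℕ)
    (K : Fin m → κ → V → V)
    (hK : ∀ k x, ∑ i, ‖K k i x‖ ^ 2 = ‖x‖ ^ 2) (x : V) :
    ∑ o : Fin m → κ, ‖Fin.foldl m (fun v k => K k (o k) v) x‖ ^ 2 = ‖x‖ ^ 2 := by
  induction m generalizing x with
  | zero => simp
  | succ m ih =>
    rw [← (Fin.consEquiv fun _ => κ).sum_comp, Fintype.sum_prod_type]
    simp only [Fin.consEquiv_apply, Fin.foldl_succ, Fin.cons_zero, Fin.cons_succ]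
    rw [← hK 0 x]
    exact Finset.sum_congr rfl fun i _ => ih (fun k => K k.succ) (fun k => hK k.succ) _

variable [DecidableEq ι]

/-- The measurement between two queries of a trial: outcome `i₀` keeps the component in the
span of `b i₀` and the `b i`, `i ∈ S`, coherently; any other outcome `i ∉ S` projects onto `b i`;
the outcomes in `S` have the zero operator and never occur. -/
noncomputable def midKraus (b : OrthonormalBasis ι ℂ E) (i₀ : ι) (S : Finset ι) (i : ι) :
    E →L[ℂ] E :=
  if i = i₀ then coordProj b (insert i₀ S) else if i ∈ S then 0 else rankOne ℂ (b i) (b i)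

lemma sum_star_midKraus [CompleteSpace E] (b : OrthonormalBasis ι ℂ E) (i₀ : ι) (S : Finset ι) :
    ∑ i, star (midKraus b i₀ S i) * midKraus b i₀ S i = 1 := by
  have hidem : ∀ S : Finset ι, star (coordProj b S) * coordProj b S = coordProj b S := by
    intro S
    rw [(isSelfAdjoint_coordProj b S).star_eq]
    ext x
    simp [coordProj_coordProj]
  have h : ∀ i, star (midKraus b i₀ S i) * midKraus b i₀ S i =
      (if i = i₀ then coordProj b (insert i₀ S) else 0) +
        if i ∈ insert i₀ S then 0 else rankOne ℂ (b i) (b i) := by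
    intro i
    by_cases h1 : i = i₀
    · simp [midKraus, h1, hidem]
    · by_cases h2 : i ∈ S
      · simp [midKraus, h1, h2]
      · have h3 := hidem {i}
        simp only [coordProj, Finset.sum_singleton] at h3
        simp [midKraus, h1, h2, h3]
  simp_rw [h]
  rw [Finset.sum_add_distrib, Finset.sum_ite_eq' Finset.univ i₀, if_pos (Finset.mem_univ _),
    Finset.sum_ite, Finset.sum_const_zero, zero_add, coordProj]
  have := b.sum_rankOne_eq_id
  rw [← Finset.sum_filter_add_sum_filter_not Finset.univ (· ∈ insert i₀ S)] at this
  rw [Finset.filter_univ_mem] at this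
  exact this

/-- The operators of the rounds of a trial with `m + 1` rounds. -/
noncomputable def stepKraus (b : OrthonormalBasis ι ℂ E) (i₀ : ι) (S : Finset ι) {m : ℕ}
    (k : Fin (m + 1)) (i : ι) : E →L[ℂ] E :=
  if k = Fin.last m then resetKraus b i₀ i else midKraus b i₀ S i

/-- The unnormalized state after a trial with outcomes `o`, started in `x`. -/
noncomputable def trialState (b : OrthonormalBasis ι ℂ E) (i₀ : ι) (S : Finset ι) (A : E →L[ℂ] E)
    {m : ℕ} (o : Fin (m + 1) → ι) (x : E) : E :=
  Fin.foldl (m + 1) (fun v k => stepKraus b i₀ S k (o k) (A v)) x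

/-- The amplitude of the outcomes `o` in a trial started in `b i₀`. -/
noncomputable def trialAmplitude (b : OrthonormalBasis ι ℂ E) (i₀ : ι) (S : Finset ι)
    (A : E →L[ℂ] E) {m : ℕ} (o : Fin (m + 1) → ι) : ℂ :=
  inner ℂ (b (o (Fin.last m)))
    (A (Fin.foldl m (fun v k => midKraus b i₀ S (o k.castSucc) (A v)) (b i₀)))

lemma trialState_basis (b : OrthonormalBasis ι ℂ E) (i₀ : ι) (S : Finset ι) (A : E →L[ℂ] E)
    {m : ℕ} (o : Fin (m + 1) → ι) :
    trialState b i₀ S A o (b i₀) = trialAmplitude b i₀ S A o • b i₀ := by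
  rw [trialState, Fin.foldl_succ_last, stepKraus, if_pos rfl, resetKraus, rankOne_apply,
    trialAmplitude]
  simp only [stepKraus, (Fin.castSucc_lt_last _).ne, if_false]

lemma foldl_smul {m : ℕ} (K : Fin m → E →L[ℂ] E) (c : ℂ) (x : E) :
    Fin.foldl m (fun v k => K k v) (c • x) = c • Fin.foldl m (fun v k => K k v) x := by
  induction m generalizing x with
  | zero => simp
  | succ m ih => simp only [Fin.foldl_succ, map_smul, ih (fun k => K k.succ)]

lemma trialState_smul (b : OrthonormalBasis ι ℂ E) (i₀ : ι) (S : Finset ι) (A : E →L[ℂ] E)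
    {m : ℕ} (o : Fin (m + 1) → ι) (c : ℂ) (x : E) :
    trialState b i₀ S A o (c • x) = c • trialState b i₀ S A o x :=
  foldl_smul (fun k => stepKraus b i₀ S k (o k) * A) c x

/-- Since every trial ends with a reset, the amplitudes of successive trials multiply. -/
lemma foldl_trialState (b : OrthonormalBasis ι ℂ E) (i₀ : ι) (S : Finset ι) (A : E →L[ℂ] E)
    {m N : ℕ} (o : Fin N → Fin (m + 1) → ι) :
    Fin.foldl N (fun v j => trialState b i₀ S A (o j) v) (b i₀)
      = (∏ j, trialAmplitude b i₀ S A (o j)) • b i₀ := by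
  induction N with
  | zero => simp
  | succ N ih =>
    rw [Fin.foldl_succ_last, ih (fun j => o j.castSucc), trialState_smul, trialState_basis,
      smul_smul, Fin.prod_univ_castSucc]

/-- The outcomes of a trial report a leak into the span of `S`. -/
def Detects (i₀ : ι) (S : Finset ι) {m : ℕ} (o : Fin (m + 1) → ι) : Prop :=
  (∀ k : Fin m, o k.castSucc = i₀) ∧ o (Fin.last m) ∈ S

open Classical in
/-- The detecting outcome strings are `i₀, …, i₀, i` with `i ∈ S`; their total probability is the
weight in the `S`-directions after `m + 1` postselected rounds. -/
lemma sum_detects_norm_sq (b : OrthonormalBasis ι ℂ E) {i₀ : ι} {S : Finset ι} (hi : i₀ ∉ S)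
    (A : E →L[ℂ] E) (m : ℕ) :
    ∑ o : Fin (m + 1) → ι, (if Detects i₀ S o then ‖trialAmplitude b i₀ S A o‖ ^ 2 else 0)
      = ‖coordProj b S (((coordProj b (insert i₀ S) * A) ^ (m + 1)) (b i₀))‖ ^ 2 := by
  have hpow : ∀ m, Fin.foldl m (fun v (_ : Fin m) => midKraus b i₀ S i₀ (A v)) (b i₀)
      = ((coordProj b (insert i₀ S) * A) ^ m) (b i₀) := by
    intro m
    induction m with
    | zero => simp
    | succ m ih =>
      rw [Fin.foldl_succ_last, ih, pow_succ', midKraus, if_pos rfl]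
      rfl
  rw [← (Fin.snocEquiv fun _ => ι).sum_comp, Fintype.sum_prod_type_right,
    Finset.sum_eq_single (fun _ => i₀)]
  · have h1 : ((coordProj b (insert i₀ S) * A) ^ (m + 1)) (b i₀) = coordProj b (insert i₀ S)
        (A (((coordProj b (insert i₀ S) * A) ^ m) (b i₀))) := by
      rw [pow_succ']; rfl
    rw [h1, coordProj_coordProj, Finset.inter_insert_of_notMem hi, Finset.inter_self,
      norm_coordProj_sq]
    simp [Detects, trialAmplitude, hpow]
  · intro f _ hf
    refine Finset.sum_eq_zero fun i _ => if_neg fun h => hf ?_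
    funext k
    simpa using h.1 k
  · simp

lemma sum_trialAmplitude_sq [CompleteSpace E] (b : OrthonormalBasis ι ℂ E) (i₀ : ι) (S : Finset ι)
    {A : E →L[ℂ] E} (hA : ∀ x, ‖A x‖ = ‖x‖) (m : ℕ) :
    ∑ o : Fin (m + 1) → ι, ‖trialAmplitude b i₀ S A o‖ ^ 2 = 1 := by
  have h := sum_norm_foldl_sq (m + 1) (fun k i v => stepKraus b i₀ S k i (A v)) (fun k x => by
    rw [← hA x]
    refine sum_norm_kraus_sq ?_ _
    unfold stepKraus
    split_ifs
    · exact sum_star_resetKraus b i₀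
    · exact sum_star_midKraus b i₀ S) (b i₀)
  have h2 : ∀ o : Fin (m + 1) → ι, ‖trialAmplitude b i₀ S A o‖ ^ 2 =
      ‖Fin.foldl (m + 1) (fun v k => stepKraus b i₀ S k (o k) (A v)) (b i₀)‖ ^ 2 := by
    intro o
    have := trialState_basis b i₀ S A o
    rw [trialState] at this
    rw [this, norm_smul, b.norm_eq_one, mul_one]
  simp_rw [h2]
  rw [h, b.norm_eq_one, one_pow]

end Trial

/-! ### Concentration of the number of detections -/

section Chernoff

open Classical in
/-- The number of trials among `o` whose outcome satisfies `D`. -/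
noncomputable def hits {Ω : Type*} (D : Ω → Prop) {N : ℕ} (o : Fin N → Ω) : ℝ :=
  ∑ j, if D (o j) then 1 else 0

variable {Ω : Type*} [Fintype Ω] {w : Ω → ℝ} {D : Ω → Prop}

open Classical in
/-- The exponential moment of the number of hits in `N` independent trials with outcome weights `w`.
The bound `exp x ≤ 1 + x + x ^ 2` keeps the variance proportional to `p`, which makes the number
of trials depend on `p` as needed. -/
lemma sum_prod_mul_exp_hits_le (hw0 : ∀ o, 0 ≤ w o) (hw1 : ∑ o, w o = 1) {p : ℝ}
    (hp : ∑ o, (if D o then w o else 0) = p) {x : ℝ} (hx : |x| ≤ 1) (θ : ℝ) (N : ℕ) :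
    ∑ o : Fin N → Ω, (∏ j, w (o j)) * Real.exp (x * (hits D o - θ * N))
      ≤ Real.exp (N * (p * (x + x ^ 2) - x * θ)) := by
  have hp0 : 0 ≤ p := hp ▸ Finset.sum_nonneg fun o _ => by split_ifs; exacts [hw0 o, le_rfl]
  have hfac : ∀ o : Fin N → Ω, (∏ j, w (o j)) * Real.exp (x * (hits D o - θ * N))
      = ∏ j, w (o j) * (Real.exp (x * if D (o j) then 1 else 0) * Real.exp (-(x * θ))) := by
    intro o
    rw [Finset.prod_mul_distrib, Finset.prod_mul_distrib, ← Real.exp_sum, ← Finset.mul_sum,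
      Finset.prod_const, Finset.card_univ, Fintype.card_fin, ← Real.exp_nat_mul, ← Real.exp_add,
      hits]
    congr 2
    ring
  have hone : ∑ o, w o * (Real.exp (x * if D o then 1 else 0) * Real.exp (-(x * θ)))
      = (1 + p * (Real.exp x - 1)) * Real.exp (-(x * θ)) := by
    have hterm : ∀ o, w o * (Real.exp (x * if D o then 1 else 0) * Real.exp (-(x * θ)))
        = w o * Real.exp (-(x * θ))
          + (if D o then w o else 0) * ((Real.exp x - 1) * Real.exp (-(x * θ))) := by
      intro o
      split_ifs
      · rw [mul_one]; ring
      · simp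
    simp_rw [hterm]
    rw [Finset.sum_add_distrib, ← Finset.sum_mul, ← Finset.sum_mul, hw1, hp]
    ring
  simp_rw [hfac]
  rw [← Fintype.sum_pow fun o => w o * (Real.exp (x * if D o then 1 else 0) * Real.exp (-(x * θ))),
    hone]
  have hexp : Real.exp x - 1 ≤ x + x ^ 2 := by
    have := (abs_le.mp (Real.abs_exp_sub_one_sub_id_le hx)).2
    linarith
  have hle : (1 + p * (Real.exp x - 1)) * Real.exp (-(x * θ))
      ≤ Real.exp (p * (x + x ^ 2) - x * θ) := by
    rw [sub_eq_add_neg (p * _), Real.exp_add]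
    gcongr
    have h1 := Real.add_one_le_exp (p * (x + x ^ 2))
    have h2 : p * (Real.exp x - 1) ≤ p * (x + x ^ 2) := by gcongr
    linarith
  have hnn : 0 ≤ (1 + p * (Real.exp x - 1)) * Real.exp (-(x * θ)) := by
    rw [← hone]
    exact Finset.sum_nonneg fun o _ => mul_nonneg (hw0 o) (by positivity)
  rw [Real.exp_nat_mul]
  gcongr

open Classical in
/-- Upper tail: few hits are expected, so the count rarely exceeds the threshold. -/
lemma sum_prod_hits_gt_le (hw0 : ∀ o, 0 ≤ w o) (hw1 : ∑ o, w o = 1) {p θ g : ℝ}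
    (hp : ∑ o, (if D o then w o else 0) = p) (hg : 0 < g) (hgθ : g ≤ θ) (hpθ : p ≤ θ - g) (N : ℕ) :
    ∑ o : Fin N → Ω, (∏ j, w (o j)) * (1 - if hits D o ≤ θ * N then 1 else 0)
      ≤ Real.exp (-(N * (g ^ 2 / (8 * θ)))) := by
  have hθ : 0 < θ := hg.trans_le hgθ
  set x := g / (4 * θ) with hx
  have hx0 : 0 < x := by positivity
  have hx1 : x ≤ 1 := by rw [hx, div_le_one (by positivity)]; linarith
  have hxθ : x * θ = g / 4 := by rw [hx]; field_simp
  have hrate : g ^ 2 / (8 * θ) = g * x / 2 := by rw [hx]; field_simp; norm_num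
  calc _ ≤ ∑ o : Fin N → Ω, (∏ j, w (o j)) * Real.exp (x * (hits D o - θ * N)) := by
        refine Finset.sum_le_sum fun o _ => ?_
        refine mul_le_mul_of_nonneg_left ?_ (Finset.prod_nonneg fun j _ => hw0 _)
        split_ifs with h
        · simp [(Real.exp_pos _).le]
        · rw [sub_zero]
          exact Real.one_le_exp (mul_nonneg hx0.le (by linarith))
    _ ≤ _ := sum_prod_mul_exp_hits_le hw0 hw1 hp (by rwa [abs_of_pos hx0]) θ N
    _ ≤ _ := by
        rw [Real.exp_le_exp, ← mul_neg]
        gcongr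
        rw [hrate]
        have : p * (x + x ^ 2) ≤ (θ - g) * (x + x ^ 2) := by gcongr
        nlinarith [mul_pos hg hx0, mul_pos (mul_pos hg hx0) hx0]

open Classical in
/-- Lower tail: many hits are expected, so the count rarely stays below the threshold. -/
lemma sum_prod_hits_le_le (hw0 : ∀ o, 0 ≤ w o) (hw1 : ∑ o, w o = 1) {p θ g : ℝ}
    (hp : ∑ o, (if D o then w o else 0) = p) (hg : 0 < g) (hgθ : g ≤ θ) (hpθ : θ + g ≤ p) (N : ℕ) :
    ∑ o : Fin N → Ω, (∏ j, w (o j)) * (if hits D o ≤ θ * N then 1 else 0)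
      ≤ Real.exp (-(N * (g ^ 2 / (8 * θ)))) := by
  have hθ : 0 < θ := hg.trans_le hgθ
  set x := g / (4 * θ) with hx
  have hx0 : 0 < x := by positivity
  have hx1 : x ≤ 1 := by rw [hx, div_le_one (by positivity)]; linarith
  have hxθ : x * θ = g / 4 := by rw [hx]; field_simp
  have hrate : g ^ 2 / (8 * θ) = g * x / 2 := by rw [hx]; field_simp; norm_num
  calc _ ≤ ∑ o : Fin N → Ω, (∏ j, w (o j)) * Real.exp (-x * (hits D o - θ * N)) := by
        refine Finset.sum_le_sum fun o _ => ?_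
        refine mul_le_mul_of_nonneg_left ?_ (Finset.prod_nonneg fun j _ => hw0 _)
        split_ifs with h
        · exact Real.one_le_exp (by nlinarith)
        · exact (Real.exp_pos _).le
    _ ≤ _ := sum_prod_mul_exp_hits_le hw0 hw1 hp (by rwa [abs_neg, abs_of_pos hx0]) θ N
    _ ≤ _ := by
        rw [Real.exp_le_exp, ← mul_neg]
        gcongr
        rw [hrate]
        have : p * (-x + (-x) ^ 2) ≤ (θ + g) * (-x + (-x) ^ 2) :=
          mul_le_mul_of_nonpos_right hpθ (by nlinarith)
        nlinarith [mul_pos hg hx0, mul_pos (mul_pos hg hx0) hx0]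

end Chernoff

/-! ### The testing algorithm -/

section Algorithm

lemma foldl_map_comm {α β : Type*} {q : ℕ} {f : α → Fin q → α} {f' : β → Fin q → β} (φ : α → β)
    (h : ∀ v j, f' (φ v) j = φ (f v j)) (x : α) :
    Fin.foldl q f' (φ x) = φ (Fin.foldl q f x) := by
  induction q generalizing x with
  | zero => simp
  | succ q ih =>
    rw [Fin.foldl_succ, Fin.foldl_succ, h]
    exact ih (fun v j => h v j.succ) _

lemma sum_conjTranspose_mul_toEuclideanCLM_symm {α κ : Type*} [Fintype α] [DecidableEq α]
    [Fintype κ] {K : κ → EuclideanSpace ℂ α →L[ℂ] EuclideanSpace ℂ α}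
    (hK : ∑ i, star (K i) * K i = 1) :
    ∑ i, ((Matrix.toEuclideanCLM (𝕜 := ℂ)).symm (K i))ᴴ
      * (Matrix.toEuclideanCLM (𝕜 := ℂ)).symm (K i) = 1 := by
  have h := congrArg (Matrix.toEuclideanCLM (n := α) (𝕜 := ℂ)).symm hK
  rw [map_sum, map_one] at h
  rw [← h]
  refine Finset.sum_congr rfl fun i _ => ?_
  rw [map_mul, ← Matrix.star_eq_conjTranspose]
  congr 1
  exact (map_star (Matrix.toEuclideanCLM (n := α) (𝕜 := ℂ)).symm (K i)).symm

variable {n : ℕ} {ι : Type*} [Fintype ι] [DecidableEq ι]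

/-- The operator on the joint register that acts as `M` on the queried qubits. -/
noncomputable def jointOperator (M : QubitMatrix n) :
    EuclideanSpace ℂ (JointIndex n n) →L[ℂ] EuclideanSpace ℂ (JointIndex n n) :=
  Matrix.toEuclideanCLM (𝕜 := ℂ) ((1 : QubitMatrix n) ⊗ₖ M)

/-- The outcomes of `N * m` consecutive rounds, grouped into `N` trials of `m` rounds. -/
noncomputable def groupOutcomes (ι : Type*) [Fintype ι] (N m : ℕ) :
    (Fin (N * m) → Fin (Fintype.card ι)) ≃ (Fin N → Fin m → ι) :=
  (Equiv.arrowCongr finProdFinEquiv.symm (Fintype.equivFin ι).symm).trans (Equiv.curry _ _ _)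

open Classical in
/-- `N` independent trials of `m + 1` rounds of evolution for time `s`, answering "close" if at
most a fraction `θ` of the trials detects a leak into the span of the `b i`, `i ∈ S`. -/
noncomputable def leakTester (b : OrthonormalBasis ι ℂ (EuclideanSpace ℂ (JointIndex n n)))
    (i₀ : ι) (S : Finset ι) (N m : ℕ) (s : ℝ) (hs : 0 ≤ s) (θ : ℝ) :
    NonadaptiveAlgorithm n n where
  queries := N * (m + 1)
  time _ := s
  time_nonneg _ := hs
  outcomes := Fintype.card ι
  init := WithLp.ofLp (b i₀)
  init_unit := by rw [← EuclideanSpace.norm_sq_eq, b.norm_eq_one, one_pow]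
  meas j o := (Matrix.toEuclideanCLM (𝕜 := ℂ)).symm
    (stepKraus b i₀ S (finProdFinEquiv.symm j).2 ((Fintype.equivFin ι).symm o))
  meas_complete j := by
    have h : ∑ i, star (stepKraus b i₀ S (finProdFinEquiv.symm j).2 i)
        * stepKraus b i₀ S (finProdFinEquiv.symm j).2 i = 1 := by
      unfold stepKraus
      split_ifs
      · exact sum_star_resetKraus b i₀
      · exact sum_star_midKraus b i₀ S
    rw [← (Fintype.equivFin ι).symm.sum_comp] at h
    exact sum_conjTranspose_mul_toEuclideanCLM_symm h
  accept o := if hits (Detects i₀ S) (groupOutcomes ι N (m + 1) o) ≤ θ * N then 1 else 0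
  accept_mem o := by split_ifs <;> simp

variable (b : OrthonormalBasis ι ℂ (EuclideanSpace ℂ (JointIndex n n)))
    (i₀ : ι) (S : Finset ι) (N m : ℕ) (s : ℝ) (hs : 0 ≤ s) (θ : ℝ) (H : QubitMatrix n)

lemma leakTester_outcomeProb (o : Fin (N * (m + 1)) → Fin (Fintype.card ι)) :
    (leakTester b i₀ S N m s hs θ).outcomeProb H o =
      ∏ j, ‖trialAmplitude b i₀ S (jointOperator (timeEvolution H s))
        (groupOutcomes ι N (m + 1) o j)‖ ^ 2 := by
  set A := jointOperator (timeEvolution H s) with hA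
  have hbranch : (leakTester b i₀ S N m s hs θ).branchState H o = WithLp.ofLp
      (Fin.foldl (N * (m + 1)) (fun v j => stepKraus b i₀ S (finProdFinEquiv.symm j).2
        ((Fintype.equivFin ι).symm (o j)) (A v)) (b i₀)) := by
    refine foldl_map_comm WithLp.ofLp (fun v j => ?_) (b i₀)
    rw [hA, jointOperator, ← Matrix.ofLp_toEuclideanCLM, ← Matrix.ofLp_toEuclideanCLM]
    simp only [leakTester, StarAlgEquiv.apply_symm_apply]
  change ∑ x, ‖(leakTester b i₀ S N m s hs θ).branchState H o x‖ ^ 2 = _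
  rw [hbranch, ← EuclideanSpace.norm_sq_eq, foldl_mul]
  have h := foldl_trialState b i₀ S A (groupOutcomes ι N (m + 1) o)
  have h2 : Fin.foldl N (fun v i => Fin.foldl (m + 1) (fun w k =>
      stepKraus b i₀ S (finProdFinEquiv.symm (finProdFinEquiv (i, k))).2
        ((Fintype.equivFin ι).symm (o (finProdFinEquiv (i, k)))) (A w)) v) (b i₀)
      = Fin.foldl N (fun v j => trialState b i₀ S A (groupOutcomes ι N (m + 1) o j) v) (b i₀) := by
    simp only [Equiv.symm_apply_apply]
    rfl
  rw [h2, h, norm_smul, b.norm_eq_one, mul_one, norm_prod, Finset.prod_pow]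

open Classical in
lemma leakTester_probClose : (leakTester b i₀ S N m s hs θ).probClose H =
    ∑ o : Fin N → Fin (m + 1) → ι,
      (∏ j, ‖trialAmplitude b i₀ S (jointOperator (timeEvolution H s)) (o j)‖ ^ 2)
        * (if hits (Detects i₀ S) o ≤ θ * N then 1 else 0) := by
  rw [← (groupOutcomes ι N (m + 1)).sum_comp]
  exact Finset.sum_congr rfl fun o _ =>
    congrArg (· * _) (leakTester_outcomeProb b i₀ S N m s hs θ H o)

open Classical in
lemma leakTester_probFar : (leakTester b i₀ S N m s hs θ).probFar H =
    ∑ o : Fin N → Fin (m + 1) → ι,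
      (∏ j, ‖trialAmplitude b i₀ S (jointOperator (timeEvolution H s)) (o j)‖ ^ 2)
        * (1 - if hits (Detects i₀ S) o ≤ θ * N then 1 else 0) := by
  rw [← (groupOutcomes ι N (m + 1)).sum_comp]
  exact Finset.sum_congr rfl fun o _ =>
    congrArg (· * _) (leakTester_outcomeProb b i₀ S N m s hs θ H o)

lemma leakTester_probClose_add_probFar
    (hA : ∀ x, ‖jointOperator (timeEvolution H s) x‖ = ‖x‖) :
    (leakTester b i₀ S N m s hs θ).probClose H + (leakTester b i₀ S N m s hs θ).probFar H = 1 := by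
  rw [leakTester_probClose, leakTester_probFar, ← Finset.sum_add_distrib]
  simp_rw [← mul_add, add_sub_cancel, mul_one]
  rw [← Fintype.sum_pow fun o => ‖trialAmplitude b i₀ S (jointOperator (timeEvolution H s)) o‖ ^ 2,
    sum_trialAmplitude_sq b i₀ S hA, one_pow]

/-- If the probability `p` that a single trial detects a leak is at distance at least `g` from the
threshold `θ`, then the repeated test errs with exponentially small probability. -/
theorem leakTester_correct {i₀ : ι} {S : Finset ι} (hi : i₀ ∉ S)
    (hA : ∀ x, ‖jointOperator (timeEvolution H s) x‖ = ‖x‖) {θ g : ℝ} (hg : 0 < g) (hgθ : g ≤ θ)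
    {p : ℝ} (hp : ‖coordProj b S (((coordProj b (insert i₀ S) *
      jointOperator (timeEvolution H s)) ^ (m + 1)) (b i₀))‖ ^ 2 = p) :
    (p ≤ θ - g → 1 - Real.exp (-(N * (g ^ 2 / (8 * θ))))
        ≤ (leakTester b i₀ S N m s hs θ).probClose H) ∧
      (θ + g ≤ p → 1 - Real.exp (-(N * (g ^ 2 / (8 * θ))))
        ≤ (leakTester b i₀ S N m s hs θ).probFar H) := by
  have hsum := leakTester_probClose_add_probFar b i₀ S N m s hs θ H hA
  have hw0 : ∀ o : Fin (m + 1) → ι,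
    0 ≤ ‖trialAmplitude b i₀ S (jointOperator (timeEvolution H s)) o‖ ^ 2 := fun o => by positivity
  have hw1 := sum_trialAmplitude_sq b i₀ S hA m
  have hd := (sum_detects_norm_sq b hi (jointOperator (timeEvolution H s)) m).trans hp
  constructor <;> intro h
  · have := sum_prod_hits_gt_le hw0 hw1 hd hg hgθ h N
    rw [← leakTester_probFar b i₀ S N m s hs θ H] at this
    linarith
  · have := sum_prod_hits_le_le hw0 hw1 hd hg hgθ h N
    rw [← leakTester_probClose b i₀ S N m s hs θ H] at this
    linarith

end Algorithm

/-! ### Operators acting on the queried qubits -/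

section JointOperator

variable {n : ℕ}

/-- `M ↦ 1 ⊗ M` as a homomorphism of star algebras into the operators on the joint register. -/
noncomputable def jointOperatorHom (n : ℕ) : QubitMatrix n →⋆ₐ[ℂ]
    (EuclideanSpace ℂ (JointIndex n n) →L[ℂ] EuclideanSpace ℂ (JointIndex n n)) where
  toFun := jointOperator
  map_one' := by rw [jointOperator, Matrix.one_kronecker_one, map_one]
  map_mul' M M' := by
    rw [jointOperator, jointOperator, jointOperator, ← map_mul, ← Matrix.mul_kronecker_mul, one_mul]
  map_zero' := by rw [jointOperator, Matrix.kronecker_zero, map_zero]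
  map_add' M M' := by
    rw [jointOperator, jointOperator, jointOperator, Matrix.kronecker_add, map_add]
  commutes' c := by
    rw [jointOperator, Algebra.algebraMap_eq_smul_one, Matrix.kronecker_smul,
      Matrix.one_kronecker_one, map_smul, map_one, Algebra.algebraMap_eq_smul_one]
  map_star' M := by
    rw [jointOperator, jointOperator, ← map_star, Matrix.star_eq_conjTranspose,
      Matrix.star_eq_conjTranspose, Matrix.conjTranspose_kronecker, Matrix.conjTranspose_one]

lemma jointOperator_timeEvolution (H : QubitMatrix n) (t : ℝ) :
    jointOperator (timeEvolution H t)
      = NormedSpace.exp ((-(Complex.I * (t : ℂ))) • jointOperator H) := by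
  open scoped Matrix.Norms.L2Operator in
  let _ : NormedAlgebra ℚ (QubitMatrix n) := .restrictScalars ℚ ℂ _
  let _ : NormedAlgebra ℚ (EuclideanSpace ℂ (JointIndex n n) →L[ℂ]
    EuclideanSpace ℂ (JointIndex n n)) := .restrictScalars ℚ ℂ _
  have hc : Continuous (jointOperatorHom n) :=
    (jointOperatorHom n).toAlgHom.toLinearMap.continuous_of_finiteDimensional
  have := NormedSpace.map_exp (jointOperatorHom n) hc ((-(Complex.I * (t : ℂ))) • H)
  rw [map_smul] at this
  exact this

lemma isSelfAdjoint_jointOperator {H : QubitMatrix n} (hH : H.IsHermitian) :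
    IsSelfAdjoint (jointOperator H) :=
  IsSelfAdjoint.map (f := jointOperatorHom n) hH

lemma norm_jointOperator_le (H : QubitMatrix n) : ‖jointOperator H‖ ≤ matrixSpectralNorm H := by
  have h := NonUnitalStarAlgHom.norm_apply_le
    ((jointOperatorHom n).comp
      (Matrix.toEuclideanCLM (𝕜 := ℂ) (n := QubitIndex n)).symm.toStarAlgHom)
    (Matrix.toEuclideanCLM (𝕜 := ℂ) H)
  have h2 : ‖jointOperatorHom n H‖ ≤ ‖Matrix.toEuclideanCLM (𝕜 := ℂ) H‖ := by simpa using h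
  exact h2

end JointOperator

/-! ### The Bell basis and Pauli expansions -/

section PauliBasis

variable {n : ℕ}

lemma Pauli.sum_star_mul (p q : Pauli) :
    ∑ a, ∑ b, star (p.toMatrix a b) * q.toMatrix a b = if p = q then 2 else 0 := by
  cases p <;> cases q <;> simp [Pauli.toMatrix, Fin.sum_univ_two] <;> norm_num

lemma Pauli.star_toMatrix (p : Pauli) (a b : Fin 2) : star (p.toMatrix a b) = p.toMatrix b a := by
  cases p <;> fin_cases a <;> fin_cases b <;> simp [Pauli.toMatrix]

lemma star_pauliString (P : Fin n → Pauli) (x y : QubitIndex n) :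
    star (pauliString P x y) = pauliString P y x := by
  simp only [pauliString, Matrix.of_apply, star_prod, Pauli.star_toMatrix]

/-- Pauli strings are orthogonal for the Hilbert–Schmidt inner product, which factorizes over the
qubits. -/
lemma sum_star_pauliString_mul (P Q : Fin n → Pauli) :
    ∑ x, ∑ y, star (pauliString P x y) * pauliString Q x y = if P = Q then 2 ^ n else 0 := by
  simp only [pauliString, Matrix.of_apply, star_prod, ← Finset.prod_mul_distrib]
  have h : ∀ x : QubitIndex n, ∑ y : QubitIndex n,
      ∏ i, star ((P i).toMatrix (x i) (y i)) * (Q i).toMatrix (x i) (y i)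
      = ∏ i, ∑ b, star ((P i).toMatrix (x i) b) * (Q i).toMatrix (x i) b := fun x => by
    rw [Finset.prod_univ_sum, Fintype.piFinset_univ]
  simp_rw [h]
  have h2 := Finset.prod_univ_sum (fun _ : Fin n => (Finset.univ : Finset (Fin 2)))
    (fun i a => ∑ b, star ((P i).toMatrix a b) * (Q i).toMatrix a b)
  rw [Fintype.piFinset_univ] at h2
  rw [← h2]
  simp_rw [Pauli.sum_star_mul]
  split_ifs with hPQ
  · simp [hPQ]
  · obtain ⟨i, hi⟩ := Function.ne_iff.mp hPQ
    exact Finset.prod_eq_zero (Finset.mem_univ i) (if_neg hi)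

lemma pauliString_identity : pauliString (fun _ : Fin n => Pauli.I) = 1 := by
  ext x y
  have h : ∀ a b : Fin 2, Pauli.I.toMatrix a b = if a = b then 1 else 0 := by
    intro a b
    fin_cases a <;> fin_cases b <;> simp [Pauli.toMatrix]
  simp only [pauliString, Matrix.of_apply, h, Matrix.one_apply, funext_iff,
    Finset.prod_ite_zero, Finset.mem_univ, true_implies, Finset.prod_const_one]

/-- The vector `2^(-n/2) vec M` of the joint register (auxiliary index first); its norm is
the normalized Frobenius norm of `M`, and `M = 1` gives `n` maximally entangled pairs. -/
noncomputable def choiVector (n : ℕ) : QubitMatrix n →ₗ[ℂ] EuclideanSpace ℂ (JointIndex n n) where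
  toFun M := WithLp.toLp 2 (((Real.sqrt (2 ^ n) : ℂ))⁻¹ • M.vec)
  map_add' M M' := by rw [Matrix.vec_add, smul_add, WithLp.toLp_add]
  map_smul' c M := by rw [Matrix.vec_smul, smul_comm, WithLp.toLp_smul, RingHom.id_apply]

lemma inner_choiVector (M M' : QubitMatrix n) :
    inner ℂ (choiVector n M) (choiVector n M')
      = (2 ^ n : ℂ)⁻¹ * ∑ x, ∑ y, star (M x y) * M' x y := by
  have hc : ((Real.sqrt (2 ^ n) : ℂ))⁻¹ * ((Real.sqrt (2 ^ n) : ℂ))⁻¹ = (2 ^ n : ℂ)⁻¹ := by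
    rw [← mul_inv, ← Complex.ofReal_mul, Real.mul_self_sqrt (by positivity)]
    simp
  rw [← hc, Finset.sum_comm, ← Fintype.sum_prod_type', Finset.mul_sum]
  simp only [choiVector, LinearMap.coe_mk, AddHom.coe_mk, PiLp.inner_apply,
    Pi.smul_apply, Matrix.vec, smul_eq_mul, RCLike.inner_apply, map_mul, map_inv₀,
    Complex.conj_ofReal]
  refine Finset.sum_congr rfl fun x _ => ?_
  rw [starRingEnd_apply]
  ring

lemma norm_choiVector (M : QubitMatrix n) : ‖choiVector n M‖ = normalizedFrobenius M := by
  rw [@norm_eq_sqrt_re_inner ℂ, inner_choiVector, normalizedFrobenius]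
  congr 1
  have h : (Mᴴ * M).trace = ∑ x, ∑ y, star (M x y) * M x y := by
    rw [Finset.sum_comm]
    simp [Matrix.trace, Matrix.mul_apply]
  have h2 : (2 ^ n : ℂ)⁻¹ = (((2 ^ n : ℝ)⁻¹ : ℝ) : ℂ) := by push_cast; rfl
  rw [h, h2, RCLike.re_to_complex, Complex.re_ofReal_mul]
  ring

lemma jointOperator_choiVector (M X : QubitMatrix n) :
    jointOperator M (choiVector n X) = choiVector n (M * X) := by
  simp only [choiVector, LinearMap.coe_mk, AddHom.coe_mk, jointOperator,
    Matrix.toEuclideanCLM_toLp, Matrix.mulVec_smul, Matrix.kronecker_mulVec_vec,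
    Matrix.transpose_one, Matrix.mul_one]

lemma orthonormal_choiVector_pauliString :
    Orthonormal ℂ fun P : Fin n → Pauli => choiVector n (pauliString P) := by
  rw [orthonormal_iff_ite]
  intro P Q
  rw [inner_choiVector, sum_star_pauliString_mul]
  split_ifs <;> simp

/-- The Bell basis of the joint register, labelled by the Pauli strings. -/
noncomputable def bellBasis (n : ℕ) :
    OrthonormalBasis (Fin n → Pauli) ℂ (EuclideanSpace ℂ (JointIndex n n)) :=
  OrthonormalBasis.mk orthonormal_choiVector_pauliString (by
    refine (orthonormal_choiVector_pauliString.linearIndependent.span_eq_top_of_card_eq_finrank'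
      ?_).ge
    have h4 : Fintype.card Pauli = 4 := rfl
    simp [h4, ← mul_pow])

lemma bellBasis_apply (P : Fin n → Pauli) : bellBasis n P = choiVector n (pauliString P) := by
  rw [bellBasis, OrthonormalBasis.coe_mk]

/-- The Pauli strings that a `k`-local Hamiltonian does not contain. -/
def nonlocalStrings (n k : ℕ) : Finset (Fin n → Pauli) :=
  Finset.univ.filter fun P => k < pauliWeight P

lemma identity_notMem_nonlocalStrings (k : ℕ) :
    (fun _ : Fin n => Pauli.I) ∉ nonlocalStrings n k := by
  simp [nonlocalStrings, pauliWeight]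

lemma jointOperator_bellBasis_identity (H : QubitMatrix n) :
    jointOperator H (bellBasis n fun _ => Pauli.I) = choiVector n H := by
  rw [bellBasis_apply, pauliString_identity, jointOperator_choiVector, mul_one]

lemma choiVector_sum_pauliString (α : (Fin n → Pauli) → ℂ) :
    choiVector n (∑ P, α P • pauliString P) = ∑ P, α P • bellBasis n P := by
  simp only [map_sum, map_smul, bellBasis_apply]

lemma coordProj_choiVector_of_isLocal {k : ℕ} {K : QubitMatrix n} (hK : IsLocalHamiltonian k K) :
    coordProj (bellBasis n) (nonlocalStrings n k) (choiVector n K) = 0 := by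
  obtain ⟨α, hα, rfl⟩ := hK
  rw [choiVector_sum_pauliString, map_sum]
  refine Finset.sum_eq_zero fun P _ => ?_
  rw [map_smul, coordProj_basis]
  split_ifs with h
  · rw [hα P (by simpa [nonlocalStrings] using h)]
    simp
  · simp

lemma norm_coordProj_choiVector_le {k : ℕ} {K : QubitMatrix n} (hK : IsLocalHamiltonian k K)
    (H : QubitMatrix n) :
    ‖coordProj (bellBasis n) (nonlocalStrings n k) (choiVector n H)‖
      ≤ normalizedFrobenius (H - K) := by
  rw [← norm_choiVector, map_sub]
  have h := norm_coordProj_le (bellBasis n) (nonlocalStrings n k)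
    (choiVector n H - choiVector n K)
  rwa [map_sub, coordProj_choiVector_of_isLocal hK, sub_zero] at h

/-- The Pauli coefficients of a Hermitian matrix are real. -/
lemma im_inner_bellBasis {H : QubitMatrix n} (hH : H.IsHermitian) (P : Fin n → Pauli) :
    (inner ℂ (bellBasis n P) (choiVector n H)).im = 0 := by
  refine Complex.conj_eq_iff_im.mp ?_
  rw [bellBasis_apply, inner_choiVector, map_mul, map_sum, Finset.sum_comm]
  congr 1
  · rw [map_inv₀, map_pow, map_ofNat]
  · refine Finset.sum_congr rfl fun x _ => ?_
    rw [map_sum]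
    refine Finset.sum_congr rfl fun y _ => ?_
    rw [map_mul, starRingEnd_apply, starRingEnd_apply, star_star, star_pauliString, hH.apply]

/-- Truncating the Pauli expansion of `H` gives a best `k`-local approximation. -/
lemma exists_isLocal_normalizedFrobenius_eq {H : QubitMatrix n} (hH : H.IsHermitian) (k : ℕ) :
    ∃ K, IsLocalHamiltonian k K ∧ normalizedFrobenius (H - K)
      = ‖coordProj (bellBasis n) (nonlocalStrings n k) (choiVector n H)‖ := by
  set α : (Fin n → Pauli) → ℝ := fun P =>
    if k < pauliWeight P then 0 else (inner ℂ (bellBasis n P) (choiVector n H)).re with hα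
  refine ⟨∑ P, (α P : ℂ) • pauliString P, ⟨α, fun P hP => if_pos hP, rfl⟩, ?_⟩
  rw [← norm_choiVector, map_sub, choiVector_sum_pauliString]
  congr 1
  refine (bellBasis n).repr.injective (PiLp.ext fun P => ?_)
  simp only [(bellBasis n).repr_apply_apply, inner_sub_right, inner_sum, inner_smul_right,
    (bellBasis n).inner_eq_ite, inner_coordProj]
  have hre : (((inner ℂ (bellBasis n P) (choiVector n H)).re : ℝ) : ℂ)
      = inner ℂ (bellBasis n P) (choiVector n H) :=
    Complex.ext rfl (by rw [im_inner_bellBasis hH P, Complex.ofReal_im])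
  by_cases h : k < pauliWeight P
  · simp [hα, h, nonlocalStrings]
  · simp [hα, h, nonlocalStrings, hre]

end PauliBasis

/-! ### Choice of the parameters -/

/-- The Zeno estimate separates the detection probabilities `x²` of close and far Hamiltonians:
with `μ = τ (ε₁ + ε₂) / 2` and `d = 3 τ (ε₂ - ε₁) / 8`, they lie below `μ² - d μ` and
above `μ² + d μ`. -/
lemma leak_separation {ε₁ ε₂ τ s η x : ℝ} (h1 : 0 ≤ ε₁) (h12 : ε₁ < ε₂) (hτ : 0 < τ)
    (hs : 22 * s ≤ (ε₂ - ε₁) / 16) (hτ2 : 64 * (τ ^ 2 * ε₂) ≤ ε₂ - ε₁) (hτ1 : τ ≤ 1 / 8)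
    (hx0 : 0 ≤ x) (hx : |x - τ * η| ≤ 22 * τ * s + 3 * τ ^ 3 * η) :
    (η ≤ ε₁ → x ^ 2 ≤ (τ * (ε₁ + ε₂) / 2) ^ 2
        - 3 * τ * (ε₂ - ε₁) / 8 * (τ * (ε₁ + ε₂) / 2)) ∧
      (ε₂ ≤ η → (τ * (ε₁ + ε₂) / 2) ^ 2
        + 3 * τ * (ε₂ - ε₁) / 8 * (τ * (ε₁ + ε₂) / 2) ≤ x ^ 2) := by
  obtain ⟨hl, hu⟩ := abs_le.mp hx
  set μ := τ * (ε₁ + ε₂) / 2 with hμ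
  set d := 3 * τ * (ε₂ - ε₁) / 8 with hd
  have hd0 : 0 < d := by rw [hd]; have := sub_pos.mpr h12; positivity
  have hdμ : d ≤ μ := by rw [hd, hμ]; nlinarith
  have hsτ : 22 * τ * s ≤ τ * ((ε₂ - ε₁) / 16) := by nlinarith
  constructor <;> intro h
  · have h3 : 3 * τ ^ 3 * η ≤ τ * (3 * ((ε₂ - ε₁) / 64)) := by
      have : τ ^ 2 * η ≤ (ε₂ - ε₁) / 64 := by nlinarith [sq_nonneg τ]
      nlinarith
    have hxμ : x ≤ μ - d := by
      rw [hμ, hd]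
      nlinarith
    nlinarith
  · have hτsq : τ ^ 2 ≤ 1 / 64 := by nlinarith
    have h3 : τ * ε₂ * (1 - 3 * τ ^ 2) ≤ τ * η * (1 - 3 * τ ^ 2) := by
      have : 0 ≤ 1 - 3 * τ ^ 2 := by linarith
      gcongr
    have h4 : τ * (3 * (τ ^ 2 * ε₂)) ≤ τ * (3 * ((ε₂ - ε₁) / 64)) := by
      gcongr
      linarith
    have hxμ : μ + d ≤ x := by
      rw [hμ, hd]
      nlinarith
    nlinarith

/-- The algorithm that ignores the Hamiltonian and answers by a fair coin. -/
noncomputable def coinFlip (n a : ℕ) : NonadaptiveAlgorithm n a where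
  queries := 0
  time _ := 0
  time_nonneg _ := le_rfl
  outcomes := 0
  init := Pi.single 0 1
  init_unit := by
    rw [Finset.sum_eq_single 0] <;> simp +contextual
  meas j := j.elim0
  meas_complete j := j.elim0
  accept _ := 1 / 2
  accept_mem _ := by norm_num

lemma coinFlip_outcomeProb {n a : ℕ} (H : QubitMatrix n) (o) :
    (coinFlip n a).outcomeProb H o = 1 := by
  have h : (coinFlip n a).branchState H o = (coinFlip n a).init := Fin.foldl_zero _ _
  rw [NonadaptiveAlgorithm.outcomeProb, h, (coinFlip n a).init_unit]

lemma coinFlip_probClose {n a : ℕ} (H : QubitMatrix n) : (coinFlip n a).probClose H = 1 / 2 := by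
  simp only [NonadaptiveAlgorithm.probClose, coinFlip_outcomeProb]
  change ∑ _ : Fin 0 → Fin 0, (1 : ℝ) * (1 / 2) = 1 / 2
  simp

lemma coinFlip_probFar {n a : ℕ} (H : QubitMatrix n) : (coinFlip n a).probFar H = 1 / 2 := by
  simp only [NonadaptiveAlgorithm.probFar, coinFlip_outcomeProb]
  change ∑ _ : Fin 0 → Fin 0, (1 : ℝ) * (1 - 1 / 2) = 1 / 2
  norm_num

/-- The leak tester run on the Bell basis, started in the maximally entangled state and watching
the Pauli strings of weight above `k`, solves the problem with error probability `δ`, provided that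
a trial is short, its rounds are much shorter, and there are enough trials. -/
theorem leakTester_distinguishes {n k : ℕ} {ε₁ ε₂ δ s : ℝ} {N m : ℕ} (hs : 0 ≤ s)
    (h1 : 0 ≤ ε₁) (h12 : ε₁ < ε₂) (hs2 : 22 * s ≤ (ε₂ - ε₁) / 16) (h2 : ε₂ ≤ 1)
    (hτ0 : 0 < (m + 1 : ℕ) * s) (hτ1 : (m + 1 : ℕ) * s ≤ 1 / 8)
    (hτ2 : 64 * (((m + 1 : ℕ) * s) ^ 2 * ε₂) ≤ ε₂ - ε₁)
    (hN : Real.exp (-(N * (9 / 512 * ((m + 1 : ℕ) * s) ^ 2 * (ε₂ - ε₁) ^ 2))) ≤ δ)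
    {H : QubitMatrix n} (hH : H.IsHermitian) (hH1 : matrixSpectralNorm H ≤ 1) :
    ((∃ K : QubitMatrix n, IsLocalHamiltonian k K ∧ normalizedFrobenius (H - K) ≤ ε₁) →
        1 - δ ≤ (leakTester (bellBasis n) (fun _ => Pauli.I) (nonlocalStrings n k) N m s hs
          (((m + 1 : ℕ) * s * (ε₁ + ε₂) / 2) ^ 2)).probClose H) ∧
      ((∀ K : QubitMatrix n, IsLocalHamiltonian k K → ε₂ ≤ normalizedFrobenius (H - K)) →
        1 - δ ≤ (leakTester (bellBasis n) (fun _ => Pauli.I) (nonlocalStrings n k) N m s hs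
          (((m + 1 : ℕ) * s * (ε₁ + ε₂) / 2) ^ 2)).probFar H) := by
  set τ : ℝ := (m + 1 : ℕ) * s with hτ
  set μ := τ * (ε₁ + ε₂) / 2 with hμ
  set d := 3 * τ * (ε₂ - ε₁) / 8 with hd
  have hΔ := sub_pos.mpr h12
  have hd0 : 0 < d := by positivity
  have hsum : 0 < ε₁ + ε₂ := by linarith
  have hμ0 : 0 < μ := by positivity
  have hdμ : d ≤ μ := by rw [hd, hμ]; nlinarith
  have hi := identity_notMem_nonlocalStrings (n := n) k
  have hG := isSelfAdjoint_jointOperator hH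
  have hA : ∀ x, ‖jointOperator (timeEvolution H s) x‖ = ‖x‖ := fun x => by
    rw [jointOperator_timeEvolution]
    exact norm_exp_selfAdjoint_apply hG s x
  have hz := zeno_leak_bounds (bellBasis n) hi hG ((norm_jointOperator_le H).trans hH1)
    (m := m + 1) hs (by linarith) (by linarith)
  rw [← jointOperator_timeEvolution, jointOperator_bellBasis_identity, ← hτ] at hz
  obtain ⟨hclose, hfar⟩ := leak_separation h1 h12 hτ0 hs2 hτ2 hτ1 (norm_nonneg _) hz
  obtain ⟨hc, hf⟩ := leakTester_correct (bellBasis n) N m s hs H hi hA (θ := μ ^ 2) (g := d * μ)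
    (by positivity) (by nlinarith) rfl
  have hrate : (d * μ) ^ 2 / (8 * μ ^ 2) = 9 / 512 * τ ^ 2 * (ε₂ - ε₁) ^ 2 := by
    rw [hd]
    field_simp
    norm_num
  rw [hrate] at hc hf
  constructor
  · rintro ⟨K, hK, hKε⟩
    have := hc (hclose ((norm_coordProj_choiVector_le hK H).trans hKε))
    linarith
  · intro hall
    obtain ⟨K, hK, hKeq⟩ := exists_isLocal_normalizedFrobenius_eq hH k
    have := hf (hfar (hKeq ▸ hall K hK))
    linarith

lemma leakTester_totalTime {n N m : ℕ} {ι : Type*} [Fintype ι] [DecidableEq ι]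
    (b : OrthonormalBasis ι ℂ (EuclideanSpace ℂ (JointIndex n n))) (i₀ : ι) (S : Finset ι)
    (s : ℝ) (hs : 0 ≤ s) (θ : ℝ) :
    (leakTester b i₀ S N m s hs θ).totalTime = N * ((m + 1 : ℕ) * s) := by
  change ∑ _ : Fin (N * (m + 1)), s = _
  simp [mul_assoc]

/-- Rounding up costs a constant factor only. The parameters are `a = √(ε₂ - ε₁)`, `b = √ε₂` and
`L = log (1/δ)`; `N` is the number of trials and `m + 1` the number of rounds of a trial. -/
lemma exists_trial_parameters {a b L : ℝ} (ha : 0 < a) (hab : a ≤ b) (hb : b ≤ 1)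
    (hL : 1 / 2 ≤ L) :
    ∃ N m : ℕ, 4000 * (L * (b ^ 2 / a ^ 6)) ≤ N ∧ N ≤ 4002 * (L * (b ^ 2 / a ^ 6)) ∧
      44 / (a * b) ≤ (m + 1 : ℕ) ∧ (m + 1 : ℕ) ≤ 45 / (a * b) := by
  have hb0 : 0 < b := ha.trans_le hab
  have hr : 1 ≤ b ^ 2 / a ^ 6 := by
    rw [one_le_div (by positivity)]
    calc a ^ 6 ≤ a ^ 2 := pow_le_pow_of_le_one ha.le (hab.trans hb) (by norm_num)
      _ ≤ b ^ 2 := by gcongr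
  have hab1 : 1 ≤ 1 / (a * b) := by
    rw [one_le_div (by positivity)]
    nlinarith
  have h44 : 44 / (a * b) = 44 * (1 / (a * b)) := by ring
  have h45 : 45 / (a * b) = 45 * (1 / (a * b)) := by ring
  have hM := Nat.ceil_lt_add_one (a := 44 / (a * b)) (by positivity)
  have hM1 : 0 < ⌈44 / (a * b)⌉₊ := Nat.ceil_pos.mpr (by positivity)
  have hN := Nat.ceil_lt_add_one (a := 4000 * (L * (b ^ 2 / a ^ 6))) (by positivity)
  refine ⟨⌈4000 * (L * (b ^ 2 / a ^ 6))⌉₊, ⌈44 / (a * b)⌉₊ - 1, Nat.le_ceil _, ?_, ?_, ?_⟩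
  · nlinarith
  · rw [Nat.sub_add_cancel hM1]
    exact Nat.le_ceil _
  · rw [Nat.sub_add_cancel hM1]
    linarith

lemma sqrt_sq_div_sq_pow {a b : ℝ} (ha : 0 < a) (hb : 0 < b) (j : ℕ) :
    Real.sqrt (b ^ 2 / (a ^ 2) ^ j) = b / a ^ j := by
  rw [← pow_mul, mul_comm 2 j, pow_mul, ← div_pow, Real.sqrt_sq (by positivity)]

theorem theorem1 :
    ∃ C : ℝ, 0 < C ∧
      ∀ (ε₁ ε₂ δ : ℝ) (k n : ℕ), 0 ≤ ε₁ → ε₁ < ε₂ → ε₂ ≤ 1 → 0 < δ → δ < 1 →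
        ∃ 𝒜 : NonadaptiveAlgorithm n n,
          (𝒜.queries : ℝ) ≤ C * (Real.sqrt (ε₂ / (ε₂ - ε₁) ^ 7) * Real.log (1 / δ)) ∧
          𝒜.totalTime ≤ C * (Real.sqrt (ε₂ / (ε₂ - ε₁) ^ 5) * Real.log (1 / δ)) ∧
          ∀ H : QubitMatrix n, H.IsHermitian → matrixSpectralNorm H ≤ 1 →
            ((∃ K : QubitMatrix n, IsLocalHamiltonian k K ∧
                normalizedFrobenius (H - K) ≤ ε₁) →
              1 - δ ≤ 𝒜.probClose H) ∧
            ((∀ K : QubitMatrix n, IsLocalHamiltonian k K →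
                ε₂ ≤ normalizedFrobenius (H - K)) →
              1 - δ ≤ 𝒜.probFar H) := by
  -- `4002 * 45 = 180090` for the queries, `4002 / 8` for the time.
  refine ⟨200000, by norm_num, fun ε₁ ε₂ δ k n h1 h12 h2 hδ0 hδ1 => ?_⟩
  have hL0 : 0 ≤ Real.log (1 / δ) := Real.log_nonneg ((one_le_div hδ0).mpr hδ1.le)
  rcases le_or_gt (1 / 2) δ with hδ | hδ
  · -- The budget vanishes as `δ → 1`, so no query is affordable here, and none is needed.
    refine ⟨coinFlip n n, ?_, ?_, fun H _ _ => ⟨fun _ => ?_, fun _ => ?_⟩⟩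
    · have : (coinFlip n n).queries = 0 := rfl
      rw [this, Nat.cast_zero]
      positivity
    · have : (coinFlip n n).totalTime = 0 := Finset.sum_eq_zero fun _ _ => rfl
      rw [this]
      positivity
    · rw [coinFlip_probClose]; linarith
    · rw [coinFlip_probFar]; linarith
  set L := Real.log (1 / δ) with hLdef
  have hL : 1 / 2 ≤ L := by
    have h : Real.log 2 ≤ L := Real.log_le_log (by norm_num) (by rw [le_div_iff₀ hδ0]; linarith)
    linarith [Real.log_two_gt_d9]
  have hε2 : 0 < ε₂ := h1.trans_lt h12
  have hΔ := sub_pos.mpr h12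
  obtain ⟨a, ha, hasq⟩ : ∃ a : ℝ, 0 < a ∧ a ^ 2 = ε₂ - ε₁ :=
    ⟨_, Real.sqrt_pos.mpr hΔ, Real.sq_sqrt hΔ.le⟩
  obtain ⟨b, hb, hbsq⟩ : ∃ b : ℝ, 0 < b ∧ b ^ 2 = ε₂ :=
    ⟨_, Real.sqrt_pos.mpr hε2, Real.sq_sqrt hε2.le⟩
  have hab : a ≤ b := le_of_sq_le_sq (by rw [hasq, hbsq]; linarith) hb.le
  have hb1 : b ≤ 1 := le_of_sq_le_sq (by rw [hbsq]; linarith) zero_le_one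
  obtain ⟨N, m, hN, hN', hM, hM'⟩ := exists_trial_parameters ha hab hb1 hL
  have hM0 : (0 : ℝ) < (m + 1 : ℕ) := by positivity
  -- A trial lasts for the time `a / (8 b)`, short enough for a relative error `(ε₂ - ε₁) / ε₂`.
  set s : ℝ := a / (8 * b) / (m + 1 : ℕ) with hsdef
  have hs : 0 ≤ s := by positivity
  have hτ : (m + 1 : ℕ) * s = a / (8 * b) := by rw [hsdef]; field_simp
  have hs2 : 22 * s ≤ (ε₂ - ε₁) / 16 := by
    have h : s ≤ a / (8 * b) / (44 / (a * b)) := by rw [hsdef]; gcongr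
    have h' : a / (8 * b) / (44 / (a * b)) = a ^ 2 / 352 := by field_simp; norm_num
    rw [← hasq]
    linarith
  have hτ1 : a / (8 * b) ≤ 1 / 8 := by
    rw [div_le_div_iff₀ (by positivity) (by norm_num)]
    linarith
  have hτ2 : 64 * ((a / (8 * b)) ^ 2 * ε₂) ≤ ε₂ - ε₁ := by
    rw [← hasq, ← hbsq]
    refine le_of_eq ?_
    field_simp
    norm_num
  have hNδ : Real.exp (-(N * (9 / 512 * (a / (8 * b)) ^ 2 * (ε₂ - ε₁) ^ 2))) ≤ δ := by
    have h : L ≤ N * (9 / 512 * (a / (8 * b)) ^ 2 * (ε₂ - ε₁) ^ 2) := by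
      calc L ≤ 4000 * 9 / 32768 * L := by linarith
        _ = 4000 * (L * (b ^ 2 / a ^ 6)) * (9 / 512 * (a / (8 * b)) ^ 2 * (ε₂ - ε₁) ^ 2) := by
          rw [← hasq]; field_simp; norm_num
        _ ≤ _ := by gcongr
    calc _ ≤ Real.exp (-L) := Real.exp_le_exp.mpr (neg_le_neg h)
      _ = δ := by rw [hLdef, one_div, Real.log_inv, neg_neg, Real.exp_log hδ0]
  refine ⟨leakTester (bellBasis n) (fun _ => Pauli.I) (nonlocalStrings n k) N m s hs
    (((m + 1 : ℕ) * s * (ε₁ + ε₂) / 2) ^ 2), ?_, ?_, fun H hH hH1 =>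
    leakTester_distinguishes hs h1 h12 hs2 h2 (by rw [hτ]; positivity) (by rwa [hτ])
      (by rwa [hτ]) (by rwa [hτ]) hH hH1⟩
  · have hq : (((leakTester (bellBasis n) (fun _ => Pauli.I) (nonlocalStrings n k) N m s hs
        (((m + 1 : ℕ) * s * (ε₁ + ε₂) / 2) ^ 2)).queries : ℕ) : ℝ) = N * (m + 1 : ℕ) :=
      Nat.cast_mul N (m + 1)
    rw [hq, ← hasq, ← hbsq, sqrt_sq_div_sq_pow ha hb]
    calc (N : ℝ) * (m + 1 : ℕ) ≤ 4002 * (L * (b ^ 2 / a ^ 6)) * (45 / (a * b)) := by gcongr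
      _ = 180090 * (b / a ^ 7 * L) := by field_simp; norm_num
      _ ≤ _ := by gcongr; norm_num
  · rw [leakTester_totalTime, hτ, ← hasq, ← hbsq, sqrt_sq_div_sq_pow ha hb]
    calc (N : ℝ) * (a / (8 * b)) ≤ 4002 * (L * (b ^ 2 / a ^ 6)) * (a / (8 * b)) := by gcongr
      _ = 4002 / 8 * (b / a ^ 5 * L) := by field_simp
      _ ≤ _ := by gcongr; norm_num
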